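/- **Theorem (Total correctness of the Fast Loaded Dice Roller).** Let $a_1,\dots,a_n$ ($n\ge 1$) be positive integers, $m=\sum_{i=1}^n a_i$, $k=\lceil\log_2 m\rceil$, $a_{n+1}=2^k-m$. For an array $h$ indexed by $\mathbb Z$ put $B_h(c)=2^c-\sum_{j=0}^{c}h[j]\,2^{c-j}$. *Preprocessing.* Starting from all-zero $h$ and $H$, do the following for $j=0,\dots,k$: set $d:=2B_h(j-1)-1$; then for $i=1,\dots,n+1$, if the bit of $a_i$ of weight $2^{k-j}$ is $1$, set $h[j]:=h[j]+1$, $H[d,j]:=i$, $d:=d-1$. From now on $h,H$ are the resulting tables (entries never written are $0$). *Program.* States $\sigma$ assign integers to the variables $c,d,\mathsf n$. Let $P$ be the probabilistic program $$\texttt{while } (d<B_h(c))\ \{\, c:=c+1;\ \{d:=2d\}\,[\tfrac12]\,\{d:=2d+1\};\ \texttt{if } (H[d,c]=\mathsf n+1)\ \{c:=0;\ d:=0\}\,\}.$$ Its semantics $[\![P]\!]$ maps sub-distributions on states to sub-distributions on states. It is defined by induction on programs: assignments push the sub-distribution forward, sequential composition is composition, $[\![\{C_1\}[p]\{C_2\}]\!](\mu)=[\![C_1]\!](p\mu)+[\![C_2]\!]((1-p)\mu)$,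 $[\![\texttt{if }(b)\,\{C_1\}\texttt{ else }\{C_2\}]\!](\mu)=[\![C_1]\!]([b]\mu)+[\![C_2]\!]([\neg b]\mu)$ (a missing else-branch does nothing), and $[\![\texttt{while }(b)\,\{C\}]\!]$ is the least fixed point of $\Phi(f)=\lambda\eta.\,[\neg b]\eta+f([\![C]\!]([b]\eta))$. Here $[b]\mu$ is $\mu$ restricted to the states that satisfy $b$. $P$ is *almost surely terminating with respect to* a set $M$ of sub-distributions if $[\![P]\!](\mu)$ and $\mu$ have the same total mass for every $\mu\in M$. *Invariant.* For integers $N\ge1$, $i$, $j$ let $$p(i)=\sum_{d,c:\,H[d,c]=i}2^{-c},\qquad \bar p_N(i)=p(i)\Bigl(1+\sum_{l\ge1}p(N+1)^l\Bigr),$$ $$p(i,j)=\sum_{d,c:\,H[d,c]=i,\ c>j}2^{-(c-j)},\qquad \bar p_N(i,j)=p(i,j)+p(N+1,j)\,\bar p_N(i),$$ and let $t_N(c)$ be $1$ if $H[B_h(c),c]=N+1$ and $0$ otherwise. (For $c<0$, outside the tables, $t_N(c)=0$.) Let $I_{\mathrm{FLDR}}$ be the set of all probability distributions $\mu$ on states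 for which there is an integer $N>0$ such that (a) $\mu(\mathsf n=N)=1$; (b) $\mu(0\le d\le N)=1$; (c) $\mu(0\le c\le k)=1$; (d) for all $1\le i\le N$: $\ \sum_{\sigma:\,H[\sigma(d),\sigma(c)]=i}\mu(\sigma)+\sum_{j=0}^{k-1}\mu(d\mapsto0,c\mapsto j,\mathsf n\mapsto N)\,\bar p_N(i,j)\le\bar p_N(i)$; (e) $\mu(\sigma)=\mu(\sigma')$ for all $\sigma,\sigma'$ with $\sigma(c)=\sigma'(c)$ that both satisfy $\mathsf n=N$ and $0\le d\le B_h(c)-1$; (f) $\mu(\sigma)=\mu(\sigma')$ for all $\sigma,\sigma'$ with $\sigma(c)=\sigma'(c)$ that both satisfy $\mathsf n=N$ and $B_h(c)+t_N(c)\le d\le B_h(c)+h[c]$. *Claim.* Assume that $P$ is almost surely terminating with respect to $I_{\mathrm{FLDR}}$. Let $\mu_0$ be the Dirac distribution on the state $d\mapsto0,\ c\mapsto0,\ \mathsf n\mapsto n$, and let $\mu=[\![P]\!](\mu_0)$. Then $$\sum_{\sigma:\,H[\sigma(d),\sigma(c)]=i}\mu(\sigma)=\frac{a_i}{m}\qquad\text{for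 all }1\le i\le n.$$ -/

import Mathlib

open scoped ENNReal

noncomputable section

namespace FLDR

/-! ## Weight functions and (sub-)distributions -/

/-- Total mass of a weight function. -/
def mass {S : Type} (μ : S → ℝ≥0∞) : ℝ≥0∞ := ∑' s, μ s

/-- Sub-distributions on `S`. -/
def subDists (S : Type) : Set (S → ℝ≥0∞) := {μ | mass μ ≤ 1}

/-- Proper distributions on `S`. -/
def dists (S : Type) : Set (S → ℝ≥0∞) := {μ | mass μ = 1}

/-- The Dirac distribution. -/
def dirac {S : Type} (s : S) : S → ℝ≥0∞ := Set.indicator {s} (fun _ => 1)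

/-- The filtered weight function `[b] · μ`. -/
def filt {S : Type} (b : S → Prop) (μ : S → ℝ≥0∞) : S → ℝ≥0∞ := Set.indicator {s | b s} μ

/-- The probability `∑_{s ⊨ b} μ(s)` that `b` is satisfied in `μ`. -/
def pr {S : Type} (μ : S → ℝ≥0∞) (b : S → Prop) : ℝ≥0∞ := ∑' s : {s // b s}, μ s

/-! ## Probabilistic programs -/

/-- Program states over the variables `V`. -/
abbrev State (V : Type) : Type := V → ℤ

/-- Probabilistic programs over the variables `V`. -/
inductive Prog (V : Type) : Type where
  | skip : Prog V
  | assign (x : V) (e : State V → ℤ) : Prog V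
  | choice (C₁ : Prog V) (p : ℝ≥0∞) (hp : p ≤ 1) (C₂ : Prog V) : Prog V
  | seq (C₁ C₂ : Prog V) : Prog V
  | ite (b : State V → Prop) (C₁ C₂ : Prog V) : Prog V
  | loop (b : State V → Prop) (C : Prog V) : Prog V

/-- The characteristic functional of a loop with guard `b`, where `body` is the semantics of
the loop body: `Φ(f)(η) = [¬b]·η + f(body([b]·η))`. It is monotone in `f`. -/
def loopFunctional {V : Type} (b : State V → Prop)
    (body : (State V → ℝ≥0∞) → (State V → ℝ≥0∞)) :
    ((State V → ℝ≥0∞) → (State V → ℝ≥0∞)) →o ((State V → ℝ≥0∞) → (State V → ℝ≥0∞)) where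
  toFun f := fun η => filt (fun σ => ¬ b σ) η + f (body (filt b η))
  monotone' := fun _ _ hfg η => add_le_add le_rfl (hfg (body (filt b η)))

/-- Denotational semantics. It is defined for all `[0,∞]`-valued weight functions, which form a
complete lattice. Programs never increase mass, and the least fixed point is the pointwise
supremum of the iterates `Φⁿ(0)`, so on sub-distributions this is the usual semantics. -/
def den {V : Type} [DecidableEq V] : Prog V → (State V → ℝ≥0∞) → (State V → ℝ≥0∞)
  | .skip => fun μ => μ
  | .assign x e => fun μ σ => ∑' σ' : {σ' : State V // Function.update σ' x (e σ') = σ}, μ σ'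
  | .choice C₁ p _ C₂ => fun μ => den C₁ (p • μ) + den C₂ ((1 - p) • μ)
  | .seq C₁ C₂ => fun μ => den C₂ (den C₁ μ)
  | .ite b C₁ C₂ => fun μ => den C₁ (filt b μ) + den C₂ (filt (fun σ => ¬ b σ) μ)
  | .loop b C => OrderHom.lfp (loopFunctional b (den C))

/-- Almost sure termination with respect to a set `M` of initial (sub-)distributions. -/
def AST {V : Type} [DecidableEq V] (C : Prog V) (M : Set (State V → ℝ≥0∞)) : Prop :=
  ∀ μ ∈ M, mass μ = mass (den C μ)

/-! ## Preprocessing of the Fast Loaded Dice Roller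

The inputs are `a 1, …, a n`; the values of `a` at other arguments are not used. -/

/-- `m = a_1 + … + a_n`. -/
def total (n : ℕ) (a : ℕ → ℕ) : ℕ := ∑ i ∈ Finset.Icc 1 n, a i

/-- `k = ⌈log₂ m⌉`. -/
def depth (n : ℕ) (a : ℕ → ℕ) : ℕ := Nat.clog 2 (total n a)

/-- The inputs extended by the rejected side `a_{n+1} = 2^k - m` (here `m ≤ 2^k`). -/
def side (n : ℕ) (a : ℕ → ℕ) (i : ℕ) : ℕ :=
  if i = n + 1 then 2 ^ depth n a - total n a else a i

/-- `2^c - ∑_{j=0}^{c} h[j]·2^{c-j}`. This is an integer for `c ≥ 0`, and equals `1/2` for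
`c = -1`. -/
def bound (h : ℤ → ℤ) (c : ℤ) : ℚ :=
  (2 : ℚ) ^ c - ∑ j ∈ Finset.Icc (0 : ℤ) c, (h j : ℚ) * (2 : ℚ) ^ (c - j)

/-- Memory of the preprocessing: the array `h`, the matrix `H` (with entries `H[d,c] = H d c`),
and the column counter `d`. -/
structure Tables where
  h : ℤ → ℤ
  H : ℤ → ℤ → ℤ
  d : ℤ

/-- The body of the inner loop of the preprocessing for row `j` and side `i`. The boolean is the
last bit of `a_i >> (k - j)`; if it is set, increment `h[j]`, store `i` in `H[d,j]`, and
decrement `d`. -/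
def innerStep (n : ℕ) (a : ℕ → ℕ) (j : ℕ) (t : Tables) (i : ℕ) : Tables :=
  if (side n a i).testBit (depth n a - j) then
    { h := Function.update t.h j (t.h j + 1)
      H := Function.update t.H t.d (Function.update (t.H t.d) j i)
      d := t.d - 1 }
  else t

/-- The body of the outer loop: set `d` to `2·bound(j-1) - 1`, the last position of row `j`
(the rational `2·bound(j-1)` is an integer), then run the inner loop for `i = 1, …, n+1`. -/
def outerStep (n : ℕ) (a : ℕ → ℕ) (t : Tables) (j : ℕ) : Tables :=
  (List.range' 1 (n + 1)).foldl (innerStep n a j)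
    { t with d := ⌊2 * bound t.h ((j : ℤ) - 1)⌋ - 1 }

/-- The result of the preprocessing: the outer loop for `j = 0, …, k`, from all-zero tables. -/
def tables (n : ℕ) (a : ℕ → ℕ) : Tables :=
  (List.range (depth n a + 1)).foldl (outerStep n a)
    { h := fun _ => 0, H := fun _ _ => 0, d := 0 }

/-- The array `h`. -/
def hArr (n : ℕ) (a : ℕ → ℕ) : ℤ → ℤ := (tables n a).h

/-- The matrix `H`, as a function of `d` and `c`. -/
def hMat (n : ℕ) (a : ℕ → ℕ) : ℤ → ℤ → ℤ := (tables n a).H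

/-! ## The program -/

/-- The variables of the program. -/
inductive Var : Type where
  | c : Var
  | d : Var
  | n : Var
  deriving DecidableEq

/-- The state with given values of `d`, `c`, `n`. -/
def mkState (d c n : ℤ) : State Var
  | .c => c
  | .d => d
  | .n => n

/-- The body of the main loop, for the matrix `H`:
`c := c+1; {d := 2d} [1/2] {d := 2d+1}; if (H[d,c] = n+1) {c := 0; d := 0}`. -/
def fldrBody (H : ℤ → ℤ → ℤ) : Prog Var :=
  .seq (.assign .c (fun σ => σ .c + 1))
    (.seq
      (.choice (.assign .d (fun σ => 2 * σ .d)) 2⁻¹ (by simp)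
        (.assign .d (fun σ => 2 * σ .d + 1)))
      (.ite (fun σ => H (σ .d) (σ .c) = σ .n + 1)
        (.seq (.assign .c (fun _ => 0)) (.assign .d (fun _ => 0)))
        .skip))

/-- The Fast Loaded Dice Roller, `while (d < bound(c)) { body }`, for given tables. -/
def fldr (h : ℤ → ℤ) (H : ℤ → ℤ → ℤ) : Prog Var :=
  .loop (fun σ => (σ .d : ℚ) < bound h (σ .c)) (fldrBody H)

/-- The initial distributions of the program. -/
def initDists : Set (State Var → ℝ≥0∞) :=
  {μ | ∃ n : ℤ, 0 < n ∧ μ = dirac (mkState 0 0 n)}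

/-! ## The invariant -/

open Classical in
/-- `1` if row `c` contains the side `n+1`, otherwise `0`. -/
def isThere (n : ℤ) (h : ℤ → ℤ) (H : ℤ → ℤ → ℤ) (c : ℤ) : ℚ :=
  if H ⌊bound h c⌋ c = n + 1 then 1 else 0

/-- `prob(i) = ∑_{d,c : H[d,c]=i} 2^{-c}`. -/
def prob (H : ℤ → ℤ → ℤ) (i : ℤ) : ℝ≥0∞ :=
  ∑' q : {q : ℤ × ℤ // H q.1 q.2 = i}, (2 : ℝ≥0∞) ^ (-q.1.2)

/-- `probt(i) = prob(i) · (1 + ∑_{j ≥ 1} prob(n+1)^j)`. -/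
def probt (n : ℤ) (H : ℤ → ℤ → ℤ) (i : ℤ) : ℝ≥0∞ :=
  prob H i * (1 + ∑' j : ℕ, prob H (n + 1) ^ (j + 1))

/-- `prob(i,j) = ∑_{d,c : H[d,c]=i, c>j} 2^{-(c-j)}`. -/
def probFrom (H : ℤ → ℤ → ℤ) (i j : ℤ) : ℝ≥0∞ :=
  ∑' q : {q : ℤ × ℤ // H q.1 q.2 = i ∧ j < q.2}, (2 : ℝ≥0∞) ^ (-(q.1.2 - j))

/-- `probt(i,j) = prob(i,j) + prob(n+1,j) · probt(i)`. -/
def probtFrom (n : ℤ) (H : ℤ → ℤ → ℤ) (i j : ℤ) : ℝ≥0∞ :=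
  probFrom H i j + probFrom H (n + 1) j * probt n H i

/-- The invariant of the program, for tables `h`, `H` of depth `k`. -/
def invariant (k : ℕ) (h : ℤ → ℤ) (H : ℤ → ℤ → ℤ) : Set (State Var → ℝ≥0∞) :=
  {μ | μ ∈ dists (State Var) ∧ ∃ n : ℤ, 0 < n ∧
    pr μ (fun σ => σ .n = n) = 1 ∧
    pr μ (fun σ => 0 ≤ σ .d ∧ σ .d ≤ n) = 1 ∧
    pr μ (fun σ => 0 ≤ σ .c ∧ σ .c ≤ k) = 1 ∧
    (∀ i : ℤ, 1 ≤ i → i ≤ n →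
      pr μ (fun σ => H (σ .d) (σ .c) = i)
        + ∑ j ∈ Finset.range k, μ (mkState 0 j n) * probtFrom n H i j ≤ probt n H i) ∧
    (∀ σ σ' : State Var,
      (σ .n = n ∧ 0 ≤ σ .d ∧ (σ .d : ℚ) ≤ bound h (σ .c) - 1) →
      (σ' .n = n ∧ 0 ≤ σ' .d ∧ (σ' .d : ℚ) ≤ bound h (σ' .c) - 1) →
      σ .c = σ' .c → μ σ = μ σ') ∧
    (∀ σ σ' : State Var,
      (σ .n = n ∧ bound h (σ .c) + isThere n h H (σ .c) ≤ (σ .d : ℚ) ∧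
        (σ .d : ℚ) ≤ bound h (σ .c) + h (σ .c)) →
      (σ' .n = n ∧ bound h (σ' .c) + isThere n h H (σ' .c) ≤ (σ' .d : ℚ) ∧
        (σ' .d : ℚ) ≤ bound h (σ' .c) + h (σ' .c)) →
      σ .c = σ' .c → μ σ = μ σ')}

end FLDR

end

/-!
The probability that the sampler stops at label `i` is computed exactly, by solving a linear
equation.

The least fixed point of a loop is the sum, over the number `t` of completed iterations, of the
part of the distribution that leaves the loop after `t` iterations (`lfp_loopFunctional_apply`).
Hence every program acts linearly on weight functions (`den_add`, `den_smul`), never increases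
mass (`mass_den_le`), and the loop can be unfolded on Dirac distributions. For `V(d,c)`, the
probability of stopping at label `i` when the loop is entered at position `d` of row `c`, this
gives `V(d,c) = [H[d,c] = i]` if `d` is at least the bound of row `c`, and otherwise `V(d,c)` is
the mean of the values at the positions `2d` and `2d+1` of row `c+1`, where a rejecting leaf
(label `n+1`) has the value `V(0,0)` (`hitProb_of_not_lt`, `hitProb_of_lt`).

The preprocessing lays out a binary tree: row `c` starts with `innerCount n a c` inner nodes, and
then come its leaves, one for each side whose bit of weight `2^(k-c)` is set
(`sum_range_rowWidth`). With the leaf payoffs `g(i) = 1`, `g(n+1) = V(0,0)` and `g = 0` elsewhere,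
the sum of all values in row `k-r` is `2^(-r) ∑ (side l mod 2^(r+1)) g(l)`, by induction on `r`
from the last row upwards (`two_pow_mul_row_sum`). Row `0` is the root alone, so
`2^k V(0,0) = a_i + (2^k - m) V(0,0)`. As `V(0,0)` is finite, `V(0,0) = a_i / m`.
-/

namespace FLDR

open Function

/-! ### Linearity and mass of the denotational semantics -/

theorem filt_add {S : Type} (b : S → Prop) (μ ν : S → ℝ≥0∞) :
    filt b (μ + ν) = filt b μ + filt b ν :=
  Set.indicator_add _ _ _

theorem filt_smul {S : Type} (b : S → Prop) (r : ℝ≥0∞) (μ : S → ℝ≥0∞) :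
    filt b (r • μ) = r • filt b μ := by
  funext s
  exact Set.indicator_const_smul_apply {s | b s} r μ s

theorem filt_add_filt_not {S : Type} (b : S → Prop) (μ : S → ℝ≥0∞) :
    filt b μ + filt (fun s => ¬ b s) μ = μ :=
  Set.indicator_self_add_compl {s | b s} μ

theorem filt_dirac {S : Type} (b : S → Prop) (s : S) [Decidable (b s)] :
    filt b (dirac s) = if b s then dirac s else 0 := by
  classical
  funext x
  by_cases hx : x = s
  · subst hx
    by_cases hb : b x <;> simp [filt, dirac, hb]
  · by_cases hb : b s <;> simp [filt, dirac, hb, hx, Set.indicator_apply]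

theorem mass_add {S : Type} (μ ν : S → ℝ≥0∞) : mass (μ + ν) = mass μ + mass ν :=
  ENNReal.tsum_add

theorem mass_smul {S : Type} (r : ℝ≥0∞) (μ : S → ℝ≥0∞) : mass (r • μ) = r * mass μ :=
  ENNReal.tsum_mul_left

theorem mass_dirac {S : Type} (s : S) : mass (dirac s) = 1 := by
  classical
  unfold mass dirac
  rw [tsum_eq_single s (fun x hx => by simp [hx])]
  simp

theorem pr_add {S : Type} (μ ν : S → ℝ≥0∞) (b : S → Prop) :
    pr (μ + ν) b = pr μ b + pr ν b :=
  ENNReal.tsum_add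

theorem pr_smul {S : Type} (r : ℝ≥0∞) (μ : S → ℝ≥0∞) (b : S → Prop) :
    pr (r • μ) b = r * pr μ b :=
  ENNReal.tsum_mul_left

theorem pr_eq_mass_filt {S : Type} (μ : S → ℝ≥0∞) (b : S → Prop) : pr μ b = mass (filt b μ) :=
  tsum_subtype {s | b s} μ

theorem pr_dirac {S : Type} (s : S) (b : S → Prop) [Decidable (b s)] :
    pr (dirac s) b = if b s then 1 else 0 := by
  rw [pr_eq_mass_filt, filt_dirac]
  split_ifs
  · exact mass_dirac s
  · simp [mass]

theorem pr_le_mass {S : Type} (μ : S → ℝ≥0∞) (b : S → Prop) : pr μ b ≤ mass μ := by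
  rw [pr_eq_mass_filt]
  exact ENNReal.tsum_le_tsum fun s => Set.indicator_le_self _ _ s

/-- The semantics of a loop collects, over all numbers `t` of iterations, the weight that leaves
the loop after exactly `t` iterations. -/
theorem lfp_loopFunctional_apply {V : Type} (b : State V → Prop)
    (body : (State V → ℝ≥0∞) → (State V → ℝ≥0∞)) (η : State V → ℝ≥0∞) (σ : State V) :
    OrderHom.lfp (loopFunctional b body) η σ
      = ∑' t : ℕ, filt (fun σ => ¬ b σ) ((fun η => body (filt b η))^[t] η) σ := by
  apply le_antisymm
  · refine OrderHom.lfp_le (loopFunctional b body) (a := fun η σ =>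
      ∑' t : ℕ, filt (fun σ => ¬ b σ) ((fun η => body (filt b η))^[t] η) σ) ?_ η σ
    intro η σ
    exact (tsum_eq_zero_add' ENNReal.summable).ge
  · rw [ENNReal.tsum_eq_iSup_nat]
    refine iSup_le fun N => ?_
    induction N generalizing η with
    | zero => simp
    | succ N ih =>
      rw [← OrderHom.map_lfp (loopFunctional b body), Finset.sum_range_succ', add_comm]
      exact add_le_add le_rfl (ih (body (filt b η)))

theorem den_loop_apply {V : Type} [DecidableEq V] (b : State V → Prop) (C : Prog V)
    (η : State V → ℝ≥0∞) (σ : State V) :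
    den (.loop b C) η σ
      = ∑' t : ℕ, filt (fun σ => ¬ b σ) ((fun η => den C (filt b η))^[t] η) σ :=
  lfp_loopFunctional_apply b (den C) η σ

theorem den_loop_unfold {V : Type} [DecidableEq V] (b : State V → Prop) (C : Prog V)
    (η : State V → ℝ≥0∞) :
    den (.loop b C) η = filt (fun σ => ¬ b σ) η + den (.loop b C) (den C (filt b η)) :=
  (congrFun (OrderHom.map_lfp (loopFunctional b (den C))) η).symm

theorem den_add {V : Type} [DecidableEq V] (C : Prog V) (μ ν : State V → ℝ≥0∞) :
    den C (μ + ν) = den C μ + den C ν := by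
  induction C generalizing μ ν with
  | skip => rfl
  | assign x e => funext σ; exact ENNReal.tsum_add
  | choice C₁ p hp C₂ ih₁ ih₂ =>
    simp only [den, smul_add, ih₁, ih₂]
    exact add_add_add_comm _ _ _ _
  | seq C₁ C₂ ih₁ ih₂ => simp only [den, ih₁, ih₂]
  | ite b C₁ C₂ ih₁ ih₂ =>
    simp only [den, filt_add, ih₁, ih₂]
    exact add_add_add_comm _ _ _ _
  | loop b C ih =>
    have hT : ∀ (t : ℕ) (μ ν : State V → ℝ≥0∞), (fun η => den C (filt b η))^[t] (μ + ν)
        = (fun η => den C (filt b η))^[t] μ + (fun η => den C (filt b η))^[t] ν := by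
      intro t
      induction t with
      | zero => intros; rfl
      | succ t iht => intro μ ν; simp only [iterate_succ_apply, filt_add, ih, iht]
    funext σ
    simp only [Pi.add_apply, den_loop_apply, hT, filt_add, ENNReal.tsum_add]

theorem den_smul {V : Type} [DecidableEq V] (C : Prog V) (r : ℝ≥0∞) (μ : State V → ℝ≥0∞) :
    den C (r • μ) = r • den C μ := by
  induction C generalizing μ with
  | skip => rfl
  | assign x e => funext σ; exact ENNReal.tsum_mul_left
  | choice C₁ p hp C₂ ih₁ ih₂ =>
    simp only [den, smul_add, smul_comm _ r μ, ih₁, ih₂]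
  | seq C₁ C₂ ih₁ ih₂ => simp only [den, ih₁, ih₂]
  | ite b C₁ C₂ ih₁ ih₂ => simp only [den, filt_smul, ih₁, ih₂, smul_add]
  | loop b C ih =>
    have hT : ∀ (t : ℕ) (μ : State V → ℝ≥0∞), (fun η => den C (filt b η))^[t] (r • μ)
        = r • (fun η => den C (filt b η))^[t] μ := by
      intro t
      induction t with
      | zero => intros; rfl
      | succ t iht => intro μ; simp only [iterate_succ_apply, filt_smul, ih, iht]
    funext σ
    simp only [Pi.smul_apply, smul_eq_mul, den_loop_apply, hT, filt_smul, ENNReal.tsum_mul_left]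

theorem den_zero {V : Type} [DecidableEq V] (C : Prog V) : den C 0 = 0 := by
  simpa using den_smul C 0 0

theorem mass_den_le {V : Type} [DecidableEq V] (C : Prog V) (μ : State V → ℝ≥0∞) :
    mass (den C μ) ≤ mass μ := by
  induction C generalizing μ with
  | skip => rfl
  | assign x e =>
    unfold mass den
    rw [← ENNReal.tsum_sigma (fun (σ : State V)
      (σ' : {σ' : State V // update σ' x (e σ') = σ}) => μ σ')]
    exact ((Equiv.sigmaFiberEquiv fun σ' : State V => update σ' x (e σ')).tsum_eq μ).le
  | choice C₁ p hp C₂ ih₁ ih₂ =>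
    simp only [den, mass_add]
    refine (add_le_add (ih₁ _) (ih₂ _)).trans ?_
    rw [mass_smul, mass_smul, ← add_mul, add_tsub_cancel_of_le hp, one_mul]
  | seq C₁ C₂ ih₁ ih₂ => exact (ih₂ _).trans (ih₁ _)
  | ite b C₁ C₂ ih₁ ih₂ =>
    simp only [den, mass_add]
    refine (add_le_add (ih₁ _) (ih₂ _)).trans ?_
    rw [← mass_add, filt_add_filt_not]
  | loop b C ih =>
    simp only [mass, den_loop_apply]
    rw [ENNReal.tsum_comm, ENNReal.tsum_eq_iSup_nat]
    refine iSup_le fun N => ?_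
    induction N generalizing μ with
    | zero => simp
    | succ N ihN =>
      rw [Finset.sum_range_succ', add_comm]
      refine (add_le_add le_rfl ((ihN _).trans (ih (filt b μ)))).trans ?_
      rw [add_comm]
      change mass _ + mass _ ≤ mass _
      rw [← mass_add]
      exact (congrArg mass (filt_add_filt_not b μ)).le

theorem den_assign_dirac {V : Type} [DecidableEq V] (x : V) (e : State V → ℤ) (s : State V) :
    den (.assign x e) (dirac s) = dirac (update s x (e s)) := by
  classical
  funext σ
  change pr (dirac s) (fun σ' => update σ' x (e σ') = σ) = _
  rw [pr_dirac]
  by_cases h : update s x (e s) = σ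
  · simp [dirac, h]
  · simp [dirac, h, Ne.symm h]

/-! ### The stopping probabilities of the main loop -/

@[simp] theorem mkState_c (d c n : ℤ) : mkState d c n .c = c := rfl
@[simp] theorem mkState_d (d c n : ℤ) : mkState d c n .d = d := rfl
@[simp] theorem mkState_n (d c n : ℤ) : mkState d c n .n = n := rfl

@[simp] theorem update_mkState_c (d c n x : ℤ) :
    update (mkState d c n) .c x = mkState d x n := by
  funext v; cases v <;> simp [update]

@[simp] theorem update_mkState_d (d c n x : ℤ) :
    update (mkState d c n) .d x = mkState x c n := by
  funext v; cases v <;> simp [update]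

/-- The state in which one pass of the loop body ends after reaching position `d` of row `c`:
a rejecting leaf leads back to the root. -/
def afterReject (H : ℤ → ℤ → ℤ) (n d c : ℤ) : State Var :=
  if H d c = n + 1 then mkState 0 0 n else mkState d c n

theorem den_fldrBody_dirac (H : ℤ → ℤ → ℤ) (n d c : ℤ) :
    den (fldrBody H) (dirac (mkState d c n))
      = (2⁻¹ : ℝ≥0∞) • dirac (afterReject H n (2 * d) (c + 1))
        + (2⁻¹ : ℝ≥0∞) • dirac (afterReject H n (2 * d + 1) (c + 1)) := by
  have hseq : ∀ (C₁ C₂ : Prog Var) μ, den (.seq C₁ C₂) μ = den C₂ (den C₁ μ) := fun _ _ _ => rfl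
  have hcond : ∀ b (C₁ C₂ : Prog Var) μ,
      den (.ite b C₁ C₂) μ = den C₁ (filt b μ) + den C₂ (filt (fun σ => ¬ b σ) μ) :=
    fun _ _ _ _ => rfl
  have hite : ∀ d c : ℤ,
      den (.ite (fun σ : State Var => H (σ .d) (σ .c) = σ .n + 1)
        (.seq (.assign .c (fun _ => 0)) (.assign .d (fun _ => 0))) .skip)
        (dirac (mkState d c n)) = dirac (afterReject H n d c) := by
    intro d c
    rw [hcond, filt_dirac, filt_dirac, afterReject]
    simp only [mkState_d, mkState_c, mkState_n]
    by_cases h : H d c = n + 1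
    · simp only [h, if_true, not_true_eq_false, if_false, den_zero, add_zero, hseq,
        den_assign_dirac, update_mkState_c, update_mkState_d]
    · simp only [h, if_false, not_false_eq_true, if_true, den_zero, zero_add]
      rfl
  have hchoice : ∀ (C₁ C₂ : Prog Var) (p : ℝ≥0∞) (hp : p ≤ 1) μ,
      den (.choice C₁ p hp C₂) μ = p • den C₁ μ + (1 - p) • den C₂ μ := fun C₁ C₂ p hp μ => by
    rw [← den_smul, ← den_smul]; rfl
  simp only [fldrBody, hseq, hchoice, den_assign_dirac, update_mkState_c, update_mkState_d,
    mkState_c, mkState_d, den_add, den_smul, hite, ENNReal.one_sub_inv_two]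

/-- The probability that the loop, entered at position `d` of row `c`, stops at label `i`. -/
noncomputable def hitProb (h : ℤ → ℤ) (H : ℤ → ℤ → ℤ) (n i d c : ℤ) : ℝ≥0∞ :=
  pr (den (fldr h H) (dirac (mkState d c n))) (fun σ => H (σ .d) (σ .c) = i)

theorem hitProb_ne_top (h : ℤ → ℤ) (H : ℤ → ℤ → ℤ) (n i d c : ℤ) : hitProb h H n i d c ≠ ⊤ := by
  have h1 : hitProb h H n i d c ≤ 1 :=
    ((pr_le_mass _ _).trans (mass_den_le _ _)).trans (mass_dirac _).le
  exact ne_top_of_le_ne_top ENNReal.one_ne_top h1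

theorem hitProb_of_not_lt {h : ℤ → ℤ} {H : ℤ → ℤ → ℤ} {n i d c : ℤ}
    (hd : ¬ (d : ℚ) < bound h c) : hitProb h H n i d c = if H d c = i then 1 else 0 := by
  rw [hitProb, fldr, den_loop_unfold, filt_dirac, filt_dirac]
  simp only [mkState_d, mkState_c, hd, not_false_eq_true, if_true, if_false, den_zero, add_zero,
    pr_dirac]
  rfl

theorem hitProb_of_lt {h : ℤ → ℤ} {H : ℤ → ℤ → ℤ} {n i d c : ℤ} (hd : (d : ℚ) < bound h c) :
    hitProb h H n i d c =
      2⁻¹ * (if H (2 * d) (c + 1) = n + 1 then hitProb h H n i 0 0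
          else hitProb h H n i (2 * d) (c + 1))
      + 2⁻¹ * (if H (2 * d + 1) (c + 1) = n + 1 then hitProb h H n i 0 0
          else hitProb h H n i (2 * d + 1) (c + 1)) := by
  have hA : ∀ d c : ℤ, pr (den (fldr h H) (dirac (afterReject H n d c)))
      (fun σ => H (σ .d) (σ .c) = i)
      = if H d c = n + 1 then hitProb h H n i 0 0 else hitProb h H n i d c := by
    intro d c
    unfold afterReject
    split_ifs <;> rfl
  rw [hitProb, fldr, den_loop_unfold, filt_dirac, filt_dirac]
  simp only [mkState_d, mkState_c, hd, not_true_eq_false, if_true, if_false, zero_add]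
  rw [den_fldrBody_dirac, ← fldr, den_add, den_smul, den_smul, pr_add, pr_smul, pr_smul, hA, hA]

/-! ### The tree laid out by the preprocessing -/

/-- The bit of side `i` of weight `2^(k-c)`: the number of leaves with label `i` in row `c`.
It is meaningful for `c ≤ k`, since the subtraction is truncated. -/
def digit (n : ℕ) (a : ℕ → ℕ) (c i : ℕ) : ℕ := ((side n a i).testBit (depth n a - c)).toNat

/-- The number of leaves in row `c`. -/
def leafCount (n : ℕ) (a : ℕ → ℕ) (c : ℕ) : ℕ := ∑ i ∈ Finset.Icc 1 (n + 1), digit n a c i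

/-- The number of inner nodes in row `c`. The subtracted sum counts the nodes of the full binary
tree in row `c` that are leaves or descendants of leaves; it is at most `2^c` for `c ≤ k`. -/
def innerCount (n : ℕ) (a : ℕ → ℕ) (c : ℕ) : ℕ :=
  2 ^ c - ∑ i ∈ Finset.Icc 1 (n + 1), side n a i / 2 ^ (depth n a - c)

/-- The number of nodes in row `c`. -/
def rowWidth (n : ℕ) (a : ℕ → ℕ) : ℕ → ℕ
  | 0 => 1
  | c + 1 => 2 * innerCount n a c

theorem total_le_two_pow_depth (n : ℕ) (a : ℕ → ℕ) : total n a ≤ 2 ^ depth n a :=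
  Nat.le_pow_clog one_lt_two _

theorem sum_side (n : ℕ) (a : ℕ → ℕ) :
    ∑ i ∈ Finset.Icc 1 (n + 1), side n a i = 2 ^ depth n a := by
  rw [Finset.sum_Icc_succ_top (by omega)]
  have h : ∑ i ∈ Finset.Icc 1 n, side n a i = total n a :=
    Finset.sum_congr rfl fun i hi => by
      rw [Finset.mem_Icc] at hi
      simp [side, show i ≠ n + 1 by omega]
  rw [h]
  simp [side, total_le_two_pow_depth]

theorem side_lt {n i : ℕ} (a : ℕ → ℕ) (hi : i ∈ Finset.Icc 1 (n + 1)) :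
    side n a i < 2 ^ (depth n a + 1) := by
  have h : side n a i ≤ 2 ^ depth n a := by
    rw [← sum_side]
    exact Finset.single_le_sum (fun _ _ => Nat.zero_le _) hi
  exact h.trans_lt (Nat.pow_lt_pow_right one_lt_two (Nat.lt_succ_self _))

theorem sum_side_div_le {n : ℕ} {a : ℕ → ℕ} {c : ℕ} (hc : c ≤ depth n a) :
    ∑ i ∈ Finset.Icc 1 (n + 1), side n a i / 2 ^ (depth n a - c) ≤ 2 ^ c := by
  refine Nat.le_of_mul_le_mul_left ?_ (Nat.two_pow_pos (depth n a - c))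
  rw [← pow_add, Nat.sub_add_cancel hc, ← sum_side, Finset.mul_sum]
  exact Finset.sum_le_sum fun i _ => Nat.mul_div_le _ _

theorem innerCount_depth (n : ℕ) (a : ℕ → ℕ) : innerCount n a (depth n a) = 0 := by
  simp [innerCount, sum_side]

theorem digit_eq_div_mod (n : ℕ) (a : ℕ → ℕ) (c i : ℕ) :
    digit n a c i = side n a i / 2 ^ (depth n a - c) % 2 := by
  rw [digit, Nat.toNat_testBit]

theorem rowWidth_eq {n : ℕ} {a : ℕ → ℕ} {c : ℕ} (hc : c ≤ depth n a) :
    rowWidth n a c = innerCount n a c + leafCount n a c := by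
  have hle := sum_side_div_le hc
  cases c with
  | zero =>
    -- No side has a bit of weight above `2^k`, so the quotients in row `0` are themselves bits.
    have h : leafCount n a 0 = ∑ i ∈ Finset.Icc 1 (n + 1), side n a i / 2 ^ (depth n a - 0) := by
      refine Finset.sum_congr rfl fun i hi => ?_
      rw [digit_eq_div_mod, Nat.mod_eq_of_lt]
      rw [Nat.div_lt_iff_lt_mul (Nat.two_pow_pos _), mul_comm, Nat.sub_zero, ← pow_succ]
      exact side_lt a hi
    rw [h, rowWidth, innerCount]
    omega
  | succ c =>
    have hle' := sum_side_div_le (show c ≤ depth n a by omega)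
    have h : ∑ i ∈ Finset.Icc 1 (n + 1), side n a i / 2 ^ (depth n a - (c + 1))
        = 2 * ∑ i ∈ Finset.Icc 1 (n + 1), side n a i / 2 ^ (depth n a - c)
          + leafCount n a (c + 1) := by
      rw [leafCount, Finset.mul_sum, ← Finset.sum_add_distrib]
      refine Finset.sum_congr rfl fun i _ => ?_
      rw [digit_eq_div_mod, show depth n a - c = depth n a - (c + 1) + 1 by omega, pow_succ,
        ← Nat.div_div_eq_div_mul]
      omega
    rw [rowWidth, innerCount, innerCount]
    rw [pow_succ] at *
    omega

theorem bound_succ (h : ℤ → ℤ) (c : ℕ) :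
    bound h ((c + 1 : ℕ) : ℤ) = 2 * bound h c - h ((c + 1 : ℕ) : ℤ) := by
  have hI : Finset.Icc (0 : ℤ) ((c + 1 : ℕ) : ℤ)
      = insert ((c + 1 : ℕ) : ℤ) (Finset.Icc (0 : ℤ) c) := by
    ext x; simp only [Finset.mem_Icc, Finset.mem_insert]; omega
  have h2 : ∀ x : ℤ, (2 : ℚ) ^ (((c + 1 : ℕ) : ℤ) - x) = 2 * 2 ^ ((c : ℤ) - x) := by
    intro x
    rw [← zpow_one_add₀ (by norm_num)]
    congr 1
    push_cast; ring
  have h3 : (2 : ℚ) ^ ((c + 1 : ℕ) : ℤ) = 2 * 2 ^ (c : ℤ) := by simpa using h2 0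
  rw [bound, bound, hI, Finset.sum_insert (by simp), h3, sub_self, zpow_zero, mul_one, mul_sub,
    Finset.mul_sum]
  simp only [h2]
  rw [Finset.sum_congr rfl fun x _ => mul_left_comm (h x : ℚ) 2 (2 ^ ((c : ℤ) - x))]
  ring

theorem bound_zero (h : ℤ → ℤ) : bound h 0 = 1 - h 0 := by simp [bound]

theorem bound_eq_innerCount {n : ℕ} {a : ℕ → ℕ} {h : ℤ → ℤ} {c : ℕ} (hc : c ≤ depth n a)
    (hh : ∀ j : ℕ, j ≤ c → h j = leafCount n a j) : bound h c = innerCount n a c := by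
  have hw : (rowWidth n a c : ℚ) = innerCount n a c + leafCount n a c := by
    exact_mod_cast rowWidth_eq hc
  have hhc := hh c le_rfl
  induction c with
  | zero =>
    rw [Nat.cast_zero] at hhc ⊢
    rw [bound_zero, hhc]
    simp only [rowWidth] at hw
    push_cast at hw ⊢
    linarith
  | succ c ih =>
    have ih' := ih (by omega) (fun j hj => hh j (by omega))
      (by exact_mod_cast rowWidth_eq (by omega)) (hh c (by omega))
    rw [bound_succ, ih', hhc]
    simp only [rowWidth] at hw
    push_cast at hw ⊢
    linarith

/-- The initial value of `d` in the outer loop is the last position of the row. -/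
theorem floor_two_mul_bound {n : ℕ} {a : ℕ → ℕ} {h : ℤ → ℤ} {c : ℕ} (hc : c ≤ depth n a)
    (hh : ∀ j : ℕ, j < c → h j = leafCount n a j) :
    ⌊2 * bound h ((c : ℤ) - 1)⌋ = rowWidth n a c := by
  cases c with
  | zero => simp [bound, rowWidth]
  | succ c =>
    have h1 : (((c + 1 : ℕ) : ℤ) - 1) = (c : ℤ) := by push_cast; ring
    rw [h1, bound_eq_innerCount (by omega) fun j hj => hh j (by omega), rowWidth]
    have h2 : (2 * (innerCount n a c : ℚ)) = ((2 * innerCount n a c : ℕ) : ℤ) := by push_cast; rfl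
    rw [h2, Int.floor_intCast]

/-- The effect of the first `s` steps of the inner loop. The entries written to row `j`, from the
right to the left, are the labels of the sides whose bit is set; this is recorded by summing an
arbitrary function of the label over them. -/
theorem innerStep_foldl (n : ℕ) (a : ℕ → ℕ) (j s : ℕ) (t : Tables) :
    let u := (List.range' 1 s).foldl (innerStep n a j) t
    let q := ∑ i ∈ Finset.Icc 1 s, digit n a j i
    u.d = t.d - q ∧ u.h = update t.h j (t.h j + q) ∧
    (∀ e c, c ≠ (j : ℤ) → u.H e c = t.H e c) ∧
    (∀ e, e ≤ u.d → u.H e j = t.H e j) ∧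
    ∀ g : ℤ → ℝ≥0∞, ∑ x ∈ Finset.range q, g (u.H (t.d - x) j)
      = ∑ i ∈ Finset.Icc 1 s, (digit n a j i : ℝ≥0∞) * g i := by
  induction s with
  | zero => simp
  | succ s ih =>
    simp only [List.range'_1_concat, List.foldl_append, List.foldl_cons, List.foldl_nil,
      Finset.sum_Icc_succ_top (show 1 ≤ s + 1 by omega)]
    set u := (List.range' 1 s).foldl (innerStep n a j) t
    set q := ∑ i ∈ Finset.Icc 1 s, digit n a j i
    obtain ⟨hd, hh, hc, he, hg⟩ := ih
    rw [add_comm 1 s]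
    by_cases hb : (side n a (s + 1)).testBit (depth n a - j)
    · have hdig : digit n a j (s + 1) = 1 := by simp [digit, hb]
      rw [hdig]
      simp only [innerStep, hb, if_true]
      refine ⟨by rw [hd]; push_cast; ring, ?_, ?_, ?_, ?_⟩
      · rw [hh, update_idem, update_self]
        push_cast
        rw [add_assoc]
      · intro e c hne
        by_cases hed : e = u.d
        · subst hed; rw [update_self, update_of_ne hne, hc _ _ hne]
        · rw [update_of_ne hed, hc _ _ hne]
      · intro e hle
        rw [update_of_ne (by omega), he e (by omega)]
      · intro g
        rw [Finset.sum_range_succ, ← hg g, ← hd, update_self, update_self]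
        simp only [Nat.cast_one, one_mul]
        congr 1
        refine Finset.sum_congr rfl fun x hx => ?_
        rw [Finset.mem_range] at hx
        rw [update_of_ne (by omega)]
    · have hdig : digit n a j (s + 1) = 0 := by simp [digit, hb]
      rw [hdig]
      simp only [innerStep, hb, add_zero, Nat.cast_zero, zero_mul]
      exact ⟨hd, hh, hc, he, hg⟩

theorem outerStep_spec {n : ℕ} {a : ℕ → ℕ} {j : ℕ} (t : Tables) {w : ℤ}
    (hw : ⌊2 * bound t.h ((j : ℤ) - 1)⌋ = w) :
    (outerStep n a t j).d = w - 1 - leafCount n a j ∧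
    (outerStep n a t j).h = update t.h j (t.h j + leafCount n a j) ∧
    (∀ e c, c ≠ (j : ℤ) → (outerStep n a t j).H e c = t.H e c) ∧
    (∀ e, e ≤ (outerStep n a t j).d → (outerStep n a t j).H e j = t.H e j) ∧
    ∀ g : ℤ → ℝ≥0∞, ∑ x ∈ Finset.range (leafCount n a j), g ((outerStep n a t j).H (w - 1 - x) j)
      = ∑ i ∈ Finset.Icc 1 (n + 1), (digit n a j i : ℝ≥0∞) * g i := by
  subst hw
  exact innerStep_foldl n a j (n + 1) { t with d := ⌊2 * bound t.h ((j : ℤ) - 1)⌋ - 1 }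

/-- Row `c` of `h` and `H` is laid out as intended: `h[c]` is the number of leaves, the inner
nodes have no label, and the leaves, read from the right, carry the labels of the sides whose bit
is set. -/
structure IsRow (n : ℕ) (a : ℕ → ℕ) (h : ℤ → ℤ) (H : ℤ → ℤ → ℤ) (c : ℕ) : Prop where
  h_eq : h c = leafCount n a c
  H_inner : ∀ e : ℤ, e < innerCount n a c → H e c = 0
  sum_leaves : ∀ g : ℤ → ℝ≥0∞,
    ∑ x ∈ Finset.range (leafCount n a c), g (H ((rowWidth n a c : ℤ) - 1 - x) c)
      = ∑ i ∈ Finset.Icc 1 (n + 1), (digit n a c i : ℝ≥0∞) * g i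

theorem outerStep_foldl (n : ℕ) (a : ℕ → ℕ) (J : ℕ) (hJ : J ≤ depth n a + 1) :
    let u := (List.range J).foldl (outerStep n a) { h := fun _ => 0, H := fun _ _ => 0, d := 0 }
    (∀ c : ℕ, c < J → IsRow n a u.h u.H c) ∧
    ∀ c : ℕ, J ≤ c → u.h c = 0 ∧ ∀ e, u.H e c = 0 := by
  induction J with
  | zero => simp
  | succ J ih =>
    simp only [List.range_succ, List.foldl_append, List.foldl_cons, List.foldl_nil]
    set u := (List.range J).foldl (outerStep n a) { h := fun _ => 0, H := fun _ _ => 0, d := 0 }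
    obtain ⟨hlt, hge⟩ := ih (by omega)
    have hfloor := floor_two_mul_bound (show J ≤ depth n a by omega)
      fun j hj => (hlt j hj).h_eq
    obtain ⟨hd, hh, hc, he, hg⟩ := outerStep_spec u hfloor
    have hw : (rowWidth n a J : ℤ) = innerCount n a J + leafCount n a J := by
      exact_mod_cast rowWidth_eq (show J ≤ depth n a by omega)
    refine ⟨fun c hcJ => ?_, fun c hcJ => ?_⟩
    · rcases Nat.lt_succ_iff_lt_or_eq.mp hcJ with hlt' | rfl
      · have hne : (c : ℤ) ≠ J := by omega
        have hr := hlt c hlt'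
        refine ⟨?_, fun e hle => ?_, fun g => ?_⟩
        · rw [hh, update_of_ne hne, hr.h_eq]
        · rw [hc _ _ hne, hr.H_inner e hle]
        · simp only [hc _ _ hne, hr.sum_leaves]
      · refine ⟨?_, fun e hle => ?_, hg⟩
        · rw [hh, update_self, (hge c le_rfl).1, zero_add]
        · rw [he e (by omega), (hge c le_rfl).2]
    · have hne : (c : ℤ) ≠ J := by omega
      refine ⟨?_, fun e => ?_⟩
      · rw [hh, update_of_ne hne, (hge c (by omega)).1]
      · rw [hc _ _ hne, (hge c (by omega)).2]

theorem isRow_tables {n : ℕ} {a : ℕ → ℕ} {c : ℕ} (hc : c ≤ depth n a) :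
    IsRow n a (hArr n a) (hMat n a) c :=
  (outerStep_foldl n a (depth n a + 1) le_rfl).1 c (by omega)

theorem bound_hArr {n : ℕ} {a : ℕ → ℕ} {c : ℕ} (hc : c ≤ depth n a) :
    bound (hArr n a) c = innerCount n a c :=
  bound_eq_innerCount hc fun _ hj => (isRow_tables (hj.trans hc)).h_eq

/-- Summation over a row splits into the inner nodes and the leaves, and a function of the label
is summed over the leaves by means of the bits of the sides. -/
theorem sum_range_rowWidth {n : ℕ} {a : ℕ → ℕ} {c : ℕ} (hc : c ≤ depth n a) (F : ℤ → ℝ≥0∞)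
    (g : ℤ → ℝ≥0∞) (hF : ∀ e : ℕ, innerCount n a c ≤ e → F e = g (hMat n a e c)) :
    ∑ e ∈ Finset.range (rowWidth n a c), F e
      = ∑ e ∈ Finset.range (innerCount n a c), F e
        + ∑ i ∈ Finset.Icc 1 (n + 1), (digit n a c i : ℝ≥0∞) * g i := by
  rw [← (isRow_tables hc).sum_leaves, rowWidth_eq hc, Finset.sum_range_add,
    ← Finset.sum_range_reflect (fun x => F ((innerCount n a c + x : ℕ) : ℤ))]
  congr 1
  refine Finset.sum_congr rfl fun x hx => ?_
  rw [Finset.mem_range] at hx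
  rw [hF _ (by omega)]
  congr 2
  omega

/-! ### Solving for the value at the root -/

theorem sum_range_two_mul_eq (F : ℤ → ℝ≥0∞) (B : ℕ) :
    ∑ e ∈ Finset.range (2 * B), F e
      = ∑ d ∈ Finset.range B, (F (2 * (d : ℤ)) + F (2 * (d : ℤ) + 1)) := by
  induction B with
  | zero => simp
  | succ B ih =>
    rw [mul_add, mul_one, Finset.sum_range_succ, Finset.sum_range_succ, ih, Finset.sum_range_succ,
      add_assoc]
    push_cast
    rfl

/-- The value of position `e` of row `c`: the probability of a stop at label `i` after the loop
body has reached this position. -/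
noncomputable def nodeValue (n : ℕ) (a : ℕ → ℕ) (i e c : ℤ) : ℝ≥0∞ :=
  if hMat n a e c = (n : ℤ) + 1 then hitProb (hArr n a) (hMat n a) n i 0 0
  else hitProb (hArr n a) (hMat n a) n i e c

/-- The value of a leaf as a function of its label `l`. -/
noncomputable def payoff (n : ℕ) (a : ℕ → ℕ) (i l : ℤ) : ℝ≥0∞ :=
  if l = (n : ℤ) + 1 then hitProb (hArr n a) (hMat n a) n i 0 0
  else if l = i then 1 else 0

theorem nodeValue_leaf {n : ℕ} {a : ℕ → ℕ} (i : ℤ) {c e : ℕ} (hc : c ≤ depth n a)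
    (he : innerCount n a c ≤ e) : nodeValue n a i e c = payoff n a i (hMat n a e c) := by
  have h : ¬ ((e : ℤ) : ℚ) < bound (hArr n a) c := by
    rw [bound_hArr hc, not_lt]
    exact_mod_cast he
  rw [nodeValue, payoff, hitProb_of_not_lt h]

theorem nodeValue_inner {n : ℕ} {a : ℕ → ℕ} (i : ℤ) {c e : ℕ} (hc : c ≤ depth n a)
    (he : e < innerCount n a c) :
    nodeValue n a i e c = 2⁻¹ * (nodeValue n a i (2 * (e : ℤ)) ((c + 1 : ℕ) : ℤ)
      + nodeValue n a i (2 * (e : ℤ) + 1) ((c + 1 : ℕ) : ℤ)) := by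
  have h : ((e : ℤ) : ℚ) < bound (hArr n a) c := by
    rw [bound_hArr hc]
    exact_mod_cast he
  rw [nodeValue, (isRow_tables hc).H_inner e (by exact_mod_cast he), if_neg (by omega),
    hitProb_of_lt h, mul_add]
  push_cast
  rfl

theorem two_pow_mul_row_sum {n : ℕ} {a : ℕ → ℕ} (i : ℤ) (r c : ℕ) (h : c + r = depth n a) :
    (2 : ℝ≥0∞) ^ r * ∑ e ∈ Finset.range (rowWidth n a c), nodeValue n a i e c
      = ∑ l ∈ Finset.Icc 1 (n + 1),
          ((side n a l % 2 ^ (r + 1) : ℕ) : ℝ≥0∞) * payoff n a i l := by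
  have hdigit : ∀ l, side n a l % 2 ^ (r + 1) = side n a l % 2 ^ r + 2 ^ r * digit n a c l := by
    intro l
    rw [digit, show depth n a - c = r by omega, Nat.toNat_testBit, Nat.mod_pow_succ]
  rw [sum_range_rowWidth (by omega) (fun e => nodeValue n a i e c) (payoff n a i)
    fun e he => nodeValue_leaf i (by omega) he]
  simp only [hdigit, Nat.cast_add, Nat.cast_mul, Nat.cast_pow, Nat.cast_ofNat, add_mul,
    Finset.sum_add_distrib, mul_add, Finset.mul_sum, mul_assoc]
  congr 1
  rw [← Finset.mul_sum]
  -- It remains to evaluate the inner nodes: there are none in the last row, and in the other rows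
  -- each is the mean of its two children, which together make up the next row.
  cases r with
  | zero =>
    have hc : c = depth n a := by omega
    simp [hc, innerCount_depth, Nat.mod_one]
  | succ r =>
    rw [← two_pow_mul_row_sum i r (c + 1) (by omega), rowWidth, sum_range_two_mul_eq
      (fun e => nodeValue n a i e ((c + 1 : ℕ) : ℤ)), pow_succ, mul_assoc]
    congr 1
    rw [Finset.sum_congr rfl fun e he =>
      nodeValue_inner i (show c ≤ depth n a by omega) (Finset.mem_range.mp he), ← Finset.mul_sum,
      ← mul_assoc, ENNReal.mul_inv_cancel two_ne_zero ENNReal.ofNat_ne_top, one_mul]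

theorem hitProb_root (n : ℕ) (a : ℕ → ℕ) (ha : ∀ i, 1 ≤ i → i ≤ n → 0 < a i) {i : ℕ}
    (hi1 : 1 ≤ i) (hin : i ≤ n) :
    hitProb (hArr n a) (hMat n a) n i 0 0 = (a i : ℝ≥0∞) / (total n a : ℝ≥0∞) := by
  set v := hitProb (hArr n a) (hMat n a) n i 0 0 with hv
  have hvtop : v ≠ ⊤ := hitProb_ne_top _ _ _ _ _ _
  have hpos : 0 < total n a := (ha i hi1 hin).trans_le
    (Finset.single_le_sum (f := a) (fun _ _ => Nat.zero_le _) (Finset.mem_Icc.mpr ⟨hi1, hin⟩))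
  -- A rejection at the root would lead to the root again, so its label plays no role here.
  have hroot : nodeValue n a i 0 0 = v := by
    unfold nodeValue
    split_ifs <;> rfl
  have hrow := two_pow_mul_row_sum (n := n) (a := a) (i : ℤ) (depth n a) 0 (by omega)
  have hpay : ∀ l ∈ Finset.Icc 1 n,
      ((side n a l % 2 ^ (depth n a + 1) : ℕ) : ℝ≥0∞) * payoff n a i l
        = if l = i then (a i : ℝ≥0∞) else 0 := by
    intro l hl
    rw [Finset.mem_Icc] at hl
    rw [Nat.mod_eq_of_lt (side_lt a (Finset.mem_Icc.mpr (by omega))), payoff,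
      if_neg (by omega), side, if_neg (by omega)]
    by_cases hli : l = i
    · simp [hli]
    · simp [hli]
  have htop : payoff n a i ((n + 1 : ℕ) : ℤ) = v := by simp [payoff, hv]
  rw [Finset.sum_Icc_succ_top (by omega), Finset.sum_congr rfl hpay, Finset.sum_ite_eq',
    if_pos (Finset.mem_Icc.mpr ⟨hi1, hin⟩), htop,
    Nat.mod_eq_of_lt (side_lt a (Finset.mem_Icc.mpr (by omega))), side, if_pos rfl] at hrow
  simp only [rowWidth, Finset.sum_range_one, Nat.cast_zero, hroot] at hrow
  -- The equation is now `2^k v = a_i + (2^k - m) v`; cancelling the last term needs `v ≠ ⊤`.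
  have hsplit : (2 : ℝ≥0∞) ^ depth n a
      = total n a + ((2 ^ depth n a - total n a : ℕ) : ℝ≥0∞) := by
    rw [← Nat.cast_add, Nat.add_sub_cancel' (total_le_two_pow_depth n a)]
    push_cast
    rfl
  rw [hsplit, add_mul, ENNReal.add_left_inj
    (ENNReal.mul_ne_top (ENNReal.natCast_ne_top _) hvtop)] at hrow
  rw [ENNReal.eq_div_iff (by exact_mod_cast hpos.ne') (ENNReal.natCast_ne_top _)]
  exact hrow

end FLDR

theorem mainTheorem7 (n : ℕ) (a : ℕ → ℕ) (ha : ∀ i, 1 ≤ i → i ≤ n → 0 < a i)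
    (hAST : FLDR.AST (FLDR.fldr (FLDR.hArr n a) (FLDR.hMat n a))
      (FLDR.invariant (FLDR.depth n a) (FLDR.hArr n a) (FLDR.hMat n a)))
    (μ₀ : FLDR.State FLDR.Var → ℝ≥0∞) (hμ₀ : μ₀ ∈ FLDR.initDists)
    (hn : FLDR.pr μ₀ (fun σ => σ .n = (n : ℤ)) = 1) :
    ∀ i : ℕ, 1 ≤ i → i ≤ n →
      FLDR.pr (FLDR.den (FLDR.fldr (FLDR.hArr n a) (FLDR.hMat n a)) μ₀)
        (fun σ => FLDR.hMat n a (σ .d) (σ .c) = (i : ℤ))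
      = (a i : ℝ≥0∞) / (FLDR.total n a : ℝ≥0∞) := by
  intro i hi1 hin
  obtain ⟨N, -, rfl⟩ := hμ₀
  have hN : N = n := by
    by_contra hne
    simp [FLDR.pr_dirac, hne] at hn
  subst hN
  exact FLDR.hitProb_root n a ha hi1 hin
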